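/- For integers $k\ge 2$ and $N\ge 0$, a map $f\colon M\to\mathbb{R}^N$ is called *$k$-regular* if it is continuous and, for any $k$ distinct points $x_1,\dots,x_k$ of $M$, the vectors $f(x_1),\dots,f(x_k)$ are linearly independent in $\mathbb{R}^N$. Let $m\ge 2$ and $N\ge 0$ be integers, and let $S^m$ be the unit sphere in $\mathbb{R}^{m+1}$. Then the following are equivalent: (a) there exists a $3$-regular map $S^m\to\mathbb{R}^N$; (b) there exists a $2$-regular map $S^m\to\mathbb{R}^N$; (c) $N\ge m+2$. -/

import Mathlib

/-- A (real) `k`-regular map from a space `M` to `ℝ^N`: a continuous map that sends any `k`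
distinct points of `M` to `k` linearly independent vectors of `ℝ^N`. -/
structure IsRegularMap (k : ℕ) {M : Type*} [TopologicalSpace M] {N : ℕ}
    (f : M → EuclideanSpace ℝ (Fin N)) : Prop where
  continuous : Continuous f
  linearIndependent : ∀ x : Fin k → M, Function.Injective x →
    LinearIndependent ℝ (fun i => f (x i))

/-! For existence, use `x ↦ (1, x)`: no line meets a sphere in three points. For the bound, suppose
`f` is 2-regular and `N ≤ m + 1`. The cone `F x = ‖x‖ • f (x / ‖x‖)` is then a continuous injection
of `ℝ^(m+1)` into a space of no larger dimension, so by invariance of domain its image surrounds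
`0`. Yet 2-regularity keeps `-t • f x₀`, `t > 0`, out of the image.

Invariance of domain is deduced from Brouwer's theorem, and Brouwer from the absence of a `C^1`
retraction `r` onto the sphere. For the latter, `x + t (r x - x)` has Jacobian polynomial in `t`.
Its integral over the ball is the volume for small `t`, hence also at `t = 1`, where the Jacobian
vanishes. -/

/-! ### No `C^1` retraction onto the sphere -/

theorem LinearMap.exists_polynomial_eval_eq_det {E : Type*} [AddCommGroup E] [Module ℝ E]
    [FiniteDimensional ℝ E] (A B : E →ₗ[ℝ] E) :
    ∃ p : Polynomial ℝ, p.natDegree ≤ Module.finrank ℝ E ∧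
      ∀ t : ℝ, p.eval t = LinearMap.det (t • A + B) := by
  let b := Module.finBasis ℝ E
  refine ⟨Matrix.det ((Polynomial.X : Polynomial ℝ) • (LinearMap.toMatrix b b A).map Polynomial.C +
    (LinearMap.toMatrix b b B).map Polynomial.C), ?_, fun t => ?_⟩
  · simpa using Polynomial.natDegree_det_X_add_C_le (LinearMap.toMatrix b b A)
      (LinearMap.toMatrix b b B)
  · rw [← LinearMap.det_toMatrix b, ← Polynomial.coe_evalRingHom, RingHom.map_det]
    congr 1
    ext i j
    simp
    ring

/-- Evaluation at `1` of polynomials of bounded degree is an affine combination of evaluations at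
points arbitrarily close to `0`. -/
theorem Polynomial.exists_eval_one_eq_sum (n : ℕ) {ε : ℝ} (hε : 0 < ε) :
    ∃ (v c : Fin (n + 1) → ℝ), (∀ i, 0 < v i ∧ v i < ε) ∧ ∑ i, c i = 1 ∧
      ∀ p : Polynomial ℝ, p.natDegree ≤ n → p.eval 1 = ∑ i, c i * p.eval (v i) := by
  -- Distinct Lagrange nodes; the shift by 2 keeps even the first one strictly below `ε`.
  let v : Fin (n + 1) → ℝ := fun i => ε / (i + 2)
  have hpos (i : Fin (n + 1)) : (0 : ℝ) < (i : ℝ) + 2 := by positivity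
  have hv : Function.Injective v := by
    intro i j h
    have h' : ε / ((i : ℝ) + 2) = ε / ((j : ℝ) + 2) := h
    rw [div_eq_div_iff (hpos i).ne' (hpos j).ne'] at h'
    have := mul_left_cancel₀ hε.ne' h'
    exact Fin.ext (by exact_mod_cast (add_right_cancel this).symm)
  have key : ∀ p : Polynomial ℝ, p.natDegree ≤ n →
      p.eval 1 = ∑ i, (Lagrange.basis Finset.univ v i).eval 1 * p.eval (v i) := by
    intro p hp
    have hdeg : p.degree < (Finset.univ : Finset (Fin (n + 1))).card := by
      refine lt_of_le_of_lt Polynomial.degree_le_natDegree ?_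
      simp only [Finset.card_univ, Fintype.card_fin]
      exact_mod_cast Nat.lt_succ_of_le hp
    conv_lhs => rw [Lagrange.eq_interpolate (s := Finset.univ) (v := v) hv.injOn hdeg]
    rw [Lagrange.interpolate_apply, Polynomial.eval_finsetSum]
    refine Finset.sum_congr rfl fun i _ => ?_
    simp [mul_comm]
  refine ⟨v, fun i => (Lagrange.basis Finset.univ v i).eval 1, fun i => ⟨by positivity, ?_⟩, ?_,
    key⟩
  · rw [div_lt_iff₀ (hpos i)]
    nlinarith [(Nat.cast_nonneg (i : ℕ) : (0 : ℝ) ≤ _)]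
  · simpa using (key 1 (by simp)).symm

open MeasureTheory Metric in
/-- There is no `C^1` map into the unit sphere of a finite-dimensional Euclidean space that fixes the
unit sphere pointwise. -/
theorem ContDiff.not_retraction_sphere {E : Type*} [NormedAddCommGroup E] [InnerProductSpace ℝ E]
    [FiniteDimensional ℝ E] {r : E → E} (hr : ContDiff ℝ 1 r) (hnorm : ∀ x, ‖r x‖ = 1)
    (hfix : ∀ x, ‖x‖ = 1 → r x = x) : False := by
  let _ : MeasurableSpace E := borel E
  have : BorelSpace E := ⟨rfl⟩
  let μ : Measure E := Measure.addHaar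
  let I : E →L[ℝ] E := ContinuousLinearMap.id ℝ E
  let u : E → E := fun x => r x - x
  have hu : ContDiff ℝ 1 u := hr.sub contDiff_id
  let A : E → E →L[ℝ] E := fderiv ℝ u
  have hA : Continuous A := hu.continuous_fderiv one_ne_zero
  have huA (x : E) : HasFDerivAt u (A x) x := (hu.differentiable one_ne_zero x).hasFDerivAt
  have hrA (x : E) : HasFDerivAt r (A x + I) x := by
    convert (huA x).add (hasFDerivAt_id x) using 1
    ext y
    simp [u]
  obtain ⟨C, hC0, hC⟩ : ∃ C : ℝ, 0 < C ∧ ∀ x ∈ closedBall (0 : E) 1, ‖A x‖ ≤ C := by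
    obtain ⟨C, hC⟩ := (isCompact_closedBall (0 : E) 1).exists_bound_of_continuousOn
      hA.continuousOn
    exact ⟨max C 1, by positivity, fun x hx => (hC x hx).trans (le_max_left _ _)⟩
  obtain ⟨δ, hδ0, hδ⟩ : ∃ δ > 0, ∀ T : E →L[ℝ] E, ‖T - I‖ < δ → 0 < T.det := by
    have : {T : E →L[ℝ] E | 0 < T.det} ∈ nhds I :=
      (isOpen_lt continuous_const ContinuousLinearMap.continuous_det).mem_nhds (by simp [I, ContinuousLinearMap.det])
    obtain ⟨δ, hδ0, hδ⟩ := Metric.mem_nhds_iff.1 this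
    exact ⟨δ, hδ0, fun T hT => hδ (by rwa [mem_ball, dist_eq_norm])⟩
  have hdetcont (t : ℝ) : Continuous fun x => (t • A x + I).det :=
    ContinuousLinearMap.continuous_det.comp (by fun_prop)
  have hint (t : ℝ) : IntegrableOn (fun x => (t • A x + I).det) (ball 0 1) μ :=
    ((hdetcont t).continuousOn.integrableOn_compact (isCompact_closedBall 0 1)).mono_set
      ball_subset_closedBall
  -- For small `t`, `x + t • u x` maps the open ball bijectively onto itself with positive Jacobian,
  -- so change of variables applies.
  have hvol (t : ℝ) (ht0 : 0 < t) (ht1 : t < 1) (htC : t * C < 1) (htδ : t * C < δ) :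
      ∫ x in ball (0 : E) 1, (t • A x + I).det ∂μ = μ.real (ball 0 1) := by
    let φ : E → E := fun x => t • u x + x
    have hφ (x : E) : HasFDerivAt φ (t • A x + I) x :=
      ((huA x).const_smul t).add (hasFDerivAt_id x)
    have hφcont : Continuous φ := by
      have := hu.continuous
      fun_prop
    have hφsub (x y : E) : φ x - φ y - (x - y) = t • (u x - u y) := by
      simp only [φ, smul_sub]; abel
    have hlip (x : E) (hx : x ∈ ball (0 : E) 1) (y : E) (hy : y ∈ ball (0 : E) 1) :
        ‖φ x - φ y - (x - y)‖ ≤ t * C * ‖x - y‖ := by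
      rw [hφsub, norm_smul, Real.norm_of_nonneg ht0.le, mul_assoc]
      gcongr
      exact (convex_ball (0 : E) 1).norm_image_sub_le_of_norm_hasFDerivWithin_le
        (fun z _ => (huA z).hasFDerivWithinAt) (fun z hz => hC z (ball_subset_closedBall hz)) hy hx
    have hinj : Set.InjOn φ (ball 0 1) := by
      intro x hx y hy hxy
      have := hlip x hx y hy
      rw [hxy, sub_self, zero_sub, norm_neg] at this
      have h0 : ‖x - y‖ = 0 := by nlinarith [norm_nonneg (x - y)]
      exact sub_eq_zero.1 (norm_eq_zero.1 h0)
    have hopen : IsOpen (φ '' ball 0 1) := by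
      have happ : ApproximatesLinearOn φ ((ContinuousLinearEquiv.refl ℝ E : E ≃L[ℝ] E) : E →L[ℝ] E)
          (ball 0 1) (t * C).toNNReal := fun x hx y hy => by
        rw [Real.coe_toNNReal _ (by positivity)]
        exact hlip x hx y hy
      rcases subsingleton_or_nontrivial E with hE | hE
      · exact isOpen_discrete _
      refine happ.open_image (ContinuousLinearEquiv.refl ℝ E).toNonlinearRightInverse isOpen_ball
        (Or.inr ?_)
      rw [← NNReal.coe_lt_coe, Real.coe_toNNReal _ (by positivity)]
      simpa [ContinuousLinearEquiv.toNonlinearRightInverse] using htC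
    have hmaps : φ '' ball 0 1 ⊆ ball 0 1 := by
      rintro _ ⟨x, hx, rfl⟩
      rw [mem_ball_zero_iff] at hx ⊢
      have : φ x = (1 - t) • x + t • r x := by simp only [φ, u]; module
      calc ‖φ x‖ ≤ (1 - t) * ‖x‖ + t * ‖r x‖ := by
            rw [this]
            refine (norm_add_le _ _).trans_eq ?_
            rw [norm_smul, norm_smul, Real.norm_of_nonneg ht0.le,
              Real.norm_of_nonneg (sub_nonneg.2 ht1.le)]
        _ < 1 := by rw [hnorm]; nlinarith
    have himage : φ '' ball 0 1 = ball 0 1 := by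
      refine hmaps.antisymm ?_
      -- The image is open, and closed relative to the ball because unit vectors are fixed.
      refine (convex_ball (0 : E) 1).isPreconnected.subset_of_closure_inter_subset hopen ?_ ?_
      · refine ⟨φ 0, hmaps ⟨0, by simp, rfl⟩, 0, by simp, rfl⟩
      · rintro y ⟨hy, hy1⟩
        have hclosed : closure (φ '' ball 0 1) ⊆ φ '' closedBall 0 1 :=
          closure_minimal (Set.image_mono ball_subset_closedBall)
            ((isCompact_closedBall 0 1).image hφcont).isClosed
        obtain ⟨x, hx, rfl⟩ := hclosed hy
        refine ⟨x, ?_, rfl⟩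
        rw [mem_closedBall_zero_iff] at hx
        rw [mem_ball_zero_iff] at hy1 ⊢
        refine lt_of_le_of_ne hx fun h1 => ?_
        simp only [φ, u, hfix x h1, sub_self, smul_zero, zero_add] at hy1
        exact hy1.ne h1
    have hchange := integral_image_eq_integral_abs_det_fderiv_smul μ measurableSet_ball
      (fun x _ => (hφ x).hasFDerivWithinAt) hinj (fun _ => (1 : ℝ))
    rw [himage] at hchange
    simp only [integral_const, smul_eq_mul, mul_one, measureReal_restrict_apply_univ] at hchange
    rw [hchange]
    refine setIntegral_congr_fun measurableSet_ball fun x hx => (abs_of_pos (hδ _ ?_)).symm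
    rw [add_sub_cancel_right, norm_smul, Real.norm_of_nonneg ht0.le]
    exact (mul_le_mul_of_nonneg_left (hC x (ball_subset_closedBall hx)) ht0.le).trans_lt htδ
  -- Since `‖r‖²` is constant, the derivative of `r` never takes the value `r x`, so it is not onto.
  have hdet (x : E) : (A x + I).det = 0 := by
    by_contra hne
    have hinj : Function.Injective (A x + I : E →ₗ[ℝ] E) := by
      rw [← LinearMap.ker_eq_bot]
      by_contra hker
      exact hne (LinearMap.det_eq_zero_iff_ker_ne_bot.2 hker)
    obtain ⟨y, hy⟩ := LinearMap.injective_iff_surjective.1 hinj (r x)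
    have hsq := (hrA x).norm_sq
    simp only [hnorm, one_pow] at hsq
    have h0 := DFunLike.congr_fun (hsq.unique (hasFDerivAt_const (1 : ℝ) x)) y
    replace hy : A x y + I y = r x := hy
    simp [← mul_add, ← inner_add_right, hy, hnorm] at h0
  -- Extrapolating from small `t` to `t = 1` pointwise avoids treating the integral itself as a
  -- polynomial.
  obtain ⟨v, c, hv, hc, heval⟩ := Polynomial.exists_eval_one_eq_sum (Module.finrank ℝ E)
    (ε := min 1 (min (1 / C) (δ / C))) (by positivity)
  have hpoint (x : E) : ∑ i, c i * (v i • A x + I).det = 0 := by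
    obtain ⟨p, hp, hpe⟩ := LinearMap.exists_polynomial_eval_eq_det (A x : E →ₗ[ℝ] E) I
    have hpe' (t : ℝ) : (t • A x + I).det = p.eval t := (hpe t).symm
    have h1 := hpe' 1
    rw [one_smul, hdet x, heval p hp] at h1
    simpa only [hpe'] using h1.symm
  have hsum : ∑ i, c i * ∫ x in ball (0 : E) 1, (v i • A x + I).det ∂μ = 0 := by
    simp_rw [← integral_const_mul]
    rw [← integral_finsetSum _ fun i _ => (hint (v i)).const_mul (c i)]
    simp [hpoint]
  have hball : 0 < μ.real (ball (0 : E) 1) :=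
    ENNReal.toReal_pos (measure_ball_pos μ 0 one_pos).ne' measure_ball_lt_top.ne
  have hconst (i) : ∫ x in ball (0 : E) 1, (v i • A x + I).det ∂μ = μ.real (ball 0 1) := by
    obtain ⟨h0, h1⟩ := hv i
    rw [lt_min_iff, lt_min_iff, lt_div_iff₀ hC0, lt_div_iff₀ hC0] at h1
    exact hvol _ h0 h1.1 h1.2.1 h1.2.2
  simp_rw [hconst, ← Finset.sum_mul, hc, one_mul] at hsum
  exact hball.ne' hsum

/-! ### Brouwer's theorem and invariance of domain -/

open Metric in
/-- **Brouwer's fixed point theorem** for the closed unit ball of a finite-dimensional Euclidean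
space. -/
theorem Continuous.exists_fixedPoint_closedBall {E : Type*} [NormedAddCommGroup E]
    [InnerProductSpace ℝ E] [FiniteDimensional ℝ E] {f : E → E}
    (hf : ContinuousOn f (closedBall 0 1)) (hmaps : ∀ x, ‖x‖ ≤ 1 → ‖f x‖ ≤ 1) :
    ∃ x, ‖x‖ ≤ 1 ∧ f x = x := by
  by_contra! hfix
  let π : E → E := fun x => (max 1 ‖x‖)⁻¹ • x
  have hmax (x : E) : 0 < max 1 ‖x‖ := lt_max_of_lt_left one_pos
  have hπ : Continuous π :=
    ((continuous_const.max continuous_norm).inv₀ fun x => (hmax x).ne').smul continuous_id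
  have hπnorm (x : E) : ‖π x‖ ≤ 1 := by
    rw [norm_smul, norm_inv, Real.norm_of_nonneg (hmax x).le, inv_mul_le_iff₀ (hmax x), mul_one]
    exact le_max_right _ _
  have hπid (x : E) (hx : ‖x‖ ≤ 1) : π x = x := by simp [π, max_eq_left hx]
  let F : E → E := f ∘ π
  have hF : Continuous F := hf.comp_continuous hπ fun x => by simpa using hπnorm x
  have hFnorm (x : E) : ‖F x‖ ≤ 1 := hmaps _ (hπnorm x)
  have hFfix (x : E) : 0 < ‖x - F x‖ := by
    rw [norm_pos_iff, sub_ne_zero]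
    intro h
    have hx : ‖x‖ ≤ 1 := h ▸ hFnorm x
    exact hfix x hx (by simpa [F, hπid x hx] using h.symm)
  obtain ⟨δ, hδ0, hδ⟩ := (isCompact_closedBall (0 : E) 2).exists_forall_le'
    (continuous_id.sub hF).norm.continuousOn fun x _ => hFfix x
  obtain ⟨P, hP, hPF, -⟩ := hF.exists_contDiff_approx 1 (ε := fun _ => min δ (1 / 2))
    continuous_const fun _ => by positivity
  let χ : ContDiffBump (0 : E) := ⟨2, 3, by norm_num, by norm_num⟩
  -- `H` has no zero: within radius 2, `P` is too close to `F` to have a fixed point; beyond it, `‖P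
  -- x‖ ≤ 3 / 2 < ‖x‖`. Normalising `H (3 • x)` gives a retraction.
  let H : E → E := fun x => x - χ x • P x
  have hH : ContDiff ℝ 1 H := contDiff_id.sub (χ.contDiff.smul hP)
  have hH3 (x : E) (hx : 3 ≤ ‖x‖) : H x = x := by
    have : χ x = 0 := χ.zero_of_le_dist (by simpa using hx)
    simp [H, this]
  have hH0 (x : E) : H x ≠ 0 := by
    intro h0
    have hPx := hPF x
    rw [lt_min_iff, dist_eq_norm] at hPx
    have hxP : x = χ x • P x := sub_eq_zero.1 h0
    rcases le_or_gt ‖x‖ 2 with hx | hx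
    · have h1 : χ x = 1 := χ.one_of_mem_closedBall (by simpa using hx)
      rw [h1, one_smul] at hxP
      have := hδ x (by simpa using hx)
      change δ ≤ ‖x - F x‖ at this
      rw [← hxP] at hPx
      exact (this.trans_lt hPx.1).false
    · have h2 : ‖P x‖ ≤ 3 / 2 := by
        have := norm_le_norm_add_norm_sub' (P x) (F x)
        linarith [hFnorm x]
      have h3 : ‖x‖ ≤ ‖P x‖ := by
        conv_lhs => rw [hxP]
        rw [norm_smul, Real.norm_of_nonneg χ.nonneg]
        exact mul_le_of_le_one_left (norm_nonneg _) χ.le_one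
      linarith
  have hscale : ContDiff ℝ 1 fun x : E => H ((3 : ℝ) • x) := hH.comp (contDiff_id.const_smul _)
  refine ContDiff.not_retraction_sphere
    (r := fun x => ‖H ((3 : ℝ) • x)‖⁻¹ • H ((3 : ℝ) • x)) ?_ ?_ ?_
  · exact ((hscale.norm ℝ fun x => hH0 _).inv fun x => norm_ne_zero_iff.2 (hH0 _)).smul hscale
  · intro x
    rw [norm_smul, norm_inv, norm_norm, inv_mul_cancel₀ (norm_ne_zero_iff.2 (hH0 _))]
  · intro x hx
    have h3 : ‖(3 : ℝ) • x‖ = 3 := by simp [norm_smul, hx]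
    rw [hH3 _ h3.ge, h3, smul_smul]
    norm_num

open Metric MeasureTheory in
/-- **Invariance of domain**: an injective continuous map from the closed unit ball of a
finite-dimensional Euclidean space to the space itself maps the centre to an interior point of its
image. -/
theorem Continuous.mem_interior_image_closedBall_of_injOn {E : Type*} [NormedAddCommGroup E]
    [InnerProductSpace ℝ E] [FiniteDimensional ℝ E] {f : E → E}
    (hf : ContinuousOn f (closedBall 0 1)) (hinj : Set.InjOn f (closedBall 0 1)) :
    f 0 ∈ interior (f '' closedBall 0 1) := by
  let _ : MeasurableSpace E := borel E
  have : BorelSpace E := ⟨rfl⟩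
  let μ : Measure E := Measure.addHaar
  have hcompact : IsCompact (f '' closedBall 0 1) :=
    (isCompact_closedBall 0 1).image_of_continuousOn hf
  have : CompactSpace (closedBall (0 : E) 1) :=
    isCompact_iff_compactSpace.1 (isCompact_closedBall 0 1)
  have hemb : Topology.IsClosedEmbedding fun x : closedBall (0 : E) 1 => f x :=
    hf.domRestrict.isClosedEmbedding hinj.injective
  -- Tietze extension of the inverse of `f`.
  obtain ⟨G, hG⟩ := ContinuousMap.exists_extension' hemb
    (⟨Subtype.val, continuous_subtype_val⟩ : C(closedBall (0 : E) 1, E))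
  have hGf (x : E) (hx : x ∈ closedBall (0 : E) 1) : G (f x) = x := congrFun hG ⟨x, hx⟩
  have h0mem : (0 : E) ∈ closedBall (0 : E) 1 := by simp
  have hGf0 : G (f 0) = 0 := hGf 0 h0mem
  -- The zero of `G` survives perturbation: apply Brouwer to `x - K (f x)`.
  have hstable (K : E → E) (hK : ContinuousOn K (f '' closedBall 0 1))
      (hKG : ∀ y ∈ f '' closedBall 0 1, ‖G y - K y‖ ≤ 1) : ∃ y ∈ f '' closedBall 0 1, K y = 0 := by
    obtain ⟨x, hx, hxK⟩ := Continuous.exists_fixedPoint_closedBall (f := fun x => x - K (f x))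
      (continuousOn_id.sub (hK.comp hf (Set.mapsTo_image _ _))) fun x hx => by
        have hx' : x ∈ closedBall (0 : E) 1 := by simpa using hx
        simpa [hGf x hx'] using hKG _ (Set.mem_image_of_mem f hx')
    exact ⟨f x, ⟨x, by simpa using hx, rfl⟩, by simpa using hxK⟩
  obtain ⟨ε, hε0, hε⟩ : ∃ ε > 0, ∀ y, ‖y - f 0‖ < ε → ‖G y‖ < 1 / 4 := by
    obtain ⟨ε, hε0, hε⟩ := Metric.continuousAt_iff.1 ((map_continuous G).continuousAt (x := f 0))
      (1 / 4) (by norm_num)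
    exact ⟨ε, hε0, fun y hy => by simpa [hGf0] using hε (dist_eq_norm y (f 0) ▸ hy)⟩
  by_contra hint
  obtain ⟨c, hcε, hc⟩ : ∃ c, ‖c - f 0‖ < ε / 2 ∧ c ∉ f '' closedBall 0 1 := by
    by_contra! h
    exact hint (mem_interior_iff_mem_nhds.2 (Metric.mem_nhds_iff.2 ⟨ε / 2, by positivity,
      fun y hy => h y (by rwa [← dist_eq_norm])⟩))
  obtain ⟨δ, hδ0, hδ⟩ : ∃ δ > 0, ∀ y ∈ f '' closedBall 0 1, ε / 2 ≤ ‖y - c‖ → δ ≤ ‖G y‖ := by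
    have hS : IsCompact (f '' closedBall 0 1 ∩ {y | ε / 2 ≤ ‖y - c‖}) :=
      hcompact.inter_right (isClosed_le continuous_const (by fun_prop))
    obtain ⟨δ, hδ0, hδ⟩ := hS.exists_forall_le' (f := fun y => ‖G y‖) (a := 0)
      (map_continuous G).norm.continuousOn (by
        rintro _ ⟨⟨x, hx, rfl⟩, hxc⟩
        rw [norm_pos_iff, hGf x hx]
        rintro rfl
        rw [Set.mem_ofPred_eq, norm_sub_rev] at hxc
        exact hxc.not_gt hcε)
    exact ⟨δ, hδ0, fun y hy hyc => hδ y ⟨hy, hyc⟩⟩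
  obtain ⟨P, hP, hPG, -⟩ := (map_continuous G).exists_contDiff_approx 1
    (ε := fun _ => min δ (1 / 4) / 2) continuous_const fun _ => by positivity
  -- A smooth image of the sphere is null, so a small shift `a` frees `P - a` of zeros there.
  have hnull : μ (P '' sphere c (ε / 2)) = 0 :=
    addHaar_image_eq_zero_of_differentiableOn_of_addHaar_eq_zero μ
      (hP.differentiable one_ne_zero).differentiableOn
      (Measure.addHaar_sphere_of_ne_zero μ c (by positivity))
  obtain ⟨a, ha, haP⟩ : ∃ a ∈ ball (0 : E) (min δ (1 / 4) / 2), a ∉ P '' sphere c (ε / 2) := by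
    by_contra! h
    exact (measure_ball_pos μ (0 : E) (by positivity)).ne' (measure_mono_null h hnull)
  rw [mem_ball_zero_iff] at ha
  let Q : E → E := fun y => P y - a
  have hQ : Continuous Q := hP.continuous.sub continuous_const
  have hQG (y : E) : ‖G y - Q y‖ < min δ (1 / 4) := by
    have h1 := hPG y
    rw [dist_comm, dist_eq_norm] at h1
    calc ‖G y - Q y‖ = ‖(G y - P y) + a‖ := by simp only [Q]; abel_nf
      _ ≤ ‖G y - P y‖ + ‖a‖ := norm_add_le _ _
      _ < min δ (1 / 4) := by linarith
  -- Pushes image points near the missed point `c` radially out to the sphere about `c`, fixing the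
  -- others.
  let Φ : E → E := fun y => c + max (ε / 2 / ‖y - c‖) 1 • (y - c)
  have hyc (y : E) (hy : y ∈ f '' closedBall 0 1) : 0 < ‖y - c‖ :=
    norm_pos_iff.2 (sub_ne_zero.2 fun h => hc (h ▸ hy))
  have hΦfar (y : E) (hy : y ∈ f '' closedBall 0 1) (hfar : ε / 2 ≤ ‖y - c‖) : Φ y = y := by
    have : max (ε / 2 / ‖y - c‖) 1 = 1 := max_eq_right ((div_le_one (hyc y hy)).2 hfar)
    simp [Φ, this]
  have hΦnear (y : E) (hy : y ∈ f '' closedBall 0 1) (hnear : ‖y - c‖ ≤ ε / 2) :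
      Φ y ∈ sphere c (ε / 2) := by
    have h1 : max (ε / 2 / ‖y - c‖) 1 = ε / 2 / ‖y - c‖ :=
      max_eq_left ((one_le_div (hyc y hy)).2 hnear)
    have h2 : Φ y - c = (ε / 2 / ‖y - c‖) • (y - c) := by simp [Φ, h1]
    rw [mem_sphere_iff_norm, h2, norm_smul, Real.norm_of_nonneg (by positivity),
      div_mul_cancel₀ _ (hyc y hy).ne']
  have hΦcont : ContinuousOn Φ (f '' closedBall 0 1) := by
    have hnorm : Continuous fun y : E => ‖y - c‖ := by fun_prop
    exact continuousOn_const.add (((continuousOn_const.div hnorm.continuousOn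
      fun y hy => (hyc y hy).ne').sup continuousOn_const).smul (by fun_prop))
  -- `Q ∘ Φ` is within 1 of `G` but has no zero: far from `c`, `‖G‖ ≥ δ`; on the sphere, by the
  -- choice of `a`.
  obtain ⟨y, hy, hy0⟩ := hstable (Q ∘ Φ) (hQ.comp_continuousOn hΦcont) fun y hy => by
    rcases le_total (ε / 2) ‖y - c‖ with hfar | hnear
    · rw [Function.comp, hΦfar y hy hfar]
      linarith [hQG y, min_le_right δ (1 / 4)]
    · have h1 : ‖Φ y - f 0‖ < ε := by
        have := hΦnear y hy hnear
        rw [mem_sphere_iff_norm] at this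
        linarith [norm_sub_le_norm_sub_add_norm_sub (Φ y) c (f 0)]
      have h2 : ‖y - f 0‖ < ε := by
        linarith [norm_sub_le_norm_sub_add_norm_sub y c (f 0)]
      have h3 := norm_sub_le_norm_sub_add_norm_sub (G y) (G (Φ y)) (Q (Φ y))
      have h4 := norm_sub_le (G y) (G (Φ y))
      rw [Function.comp]
      linarith [hQG (Φ y), min_le_right δ (1 / 4), hε y h2, hε _ h1]
  rcases le_total (ε / 2) ‖y - c‖ with hfar | hnear
  · rw [Function.comp, hΦfar y hy hfar] at hy0
    have h1 := hQG y
    rw [hy0, sub_zero, lt_min_iff] at h1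
    exact h1.1.not_ge (hδ y hy hfar)
  · exact haP ⟨Φ y, hΦnear y hy hnear, sub_eq_zero.1 hy0⟩

/-! ### Regular maps on spheres -/

namespace IsRegularMap

variable {M : Type*} [TopologicalSpace M] {N : ℕ}

theorem of_succ [Infinite M] {k : ℕ} {f : M → EuclideanSpace ℝ (Fin N)}
    (hf : IsRegularMap (k + 1) f) : IsRegularMap k f where
  continuous := hf.continuous
  linearIndependent x hx := by
    obtain ⟨y, hy⟩ := (Set.finite_range x).infinite_compl.nonempty
    have := hf.linearIndependent (Fin.cons y x) (Fin.cons_injective_iff.2 ⟨hy, hx⟩)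
    exact this.comp Fin.succ (Fin.succ_injective _)

/-- Distinct points span distinct lines. Allowing `b = 0` also yields nonvanishing. -/
theorem eq_of_smul_eq_smul {f : M → EuclideanSpace ℝ (Fin N)} (hf : IsRegularMap 2 f) {x y : M}
    {a b : ℝ} (ha : a ≠ 0) (h : a • f x = b • f y) : x = y := by
  by_contra hxy
  have hinj : Function.Injective ![x, y] := by
    intro i j hij
    fin_cases i <;> fin_cases j <;> simp_all [eq_comm]
  have hli := Fintype.linearIndependent_iff.1 (hf.linearIndependent _ hinj) ![a, -b] (by simp [h])
  exact ha (hli 0)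

theorem ne_zero [Nontrivial M] {f : M → EuclideanSpace ℝ (Fin N)} (hf : IsRegularMap 2 f) (x : M) :
    f x ≠ 0 := by
  intro h0
  obtain ⟨y, hy⟩ := exists_ne x
  exact hy (hf.eq_of_smul_eq_smul (a := 1) (b := 0) one_ne_zero (by simp [h0])).symm

end IsRegularMap

open Metric in
/-- A `2`-regular map on the unit sphere of a Euclidean space `E` needs more than `dim E`
coordinates. -/
theorem IsRegularMap.finrank_lt_of_sphere {E : Type*} [NormedAddCommGroup E] [InnerProductSpace ℝ E]
    [FiniteDimensional ℝ E] [Nontrivial E] {N : ℕ}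
    {f : sphere (0 : E) 1 → EuclideanSpace ℝ (Fin N)} (hf : IsRegularMap 2 f) :
    Module.finrank ℝ E < N := by
  by_contra! hN
  obtain ⟨L, hL⟩ := (finrank_le_iff_exists_linearMap (R := ℝ) (M := EuclideanSpace ℝ (Fin N))
    (M' := E)).1 (by simpa using hN)
  have hLcont : Continuous L := L.continuous_of_finiteDimensional
  obtain ⟨x₀⟩ : Nonempty (sphere (0 : E) 1) :=
    (NormedSpace.sphere_nonempty.2 zero_le_one).to_subtype
  have : Nontrivial (sphere (0 : E) 1) := by
    refine ⟨x₀, -x₀, fun h => ?_⟩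
    have h' : (x₀ : E) = -x₀ := congrArg Subtype.val h
    have := IsAddTorsionFree.of_isTorsionFree ℝ E
    exact ne_zero_of_mem_unit_sphere x₀ (self_eq_neg.1 h')
  let u (x : E) (hx : x ≠ 0) : sphere (0 : E) 1 :=
    ⟨‖x‖⁻¹ • x, by simp [norm_smul, norm_ne_zero_iff.2 hx]⟩
  have hu (x : E) (hx : x ≠ 0) : x = ‖x‖ • (u x hx : E) := by
    simp [u, smul_smul, norm_ne_zero_iff.2 hx]
  classical
  let F : E → E := fun x => if hx : x = 0 then 0 else ‖x‖ • L (f (u x hx))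
  have hF (x : E) (hx : x ≠ 0) : F x = ‖x‖ • L (f (u x hx)) := dif_neg hx
  have hF0 : F 0 = 0 := dif_pos rfl
  have hFne (x : E) (hx : x ≠ 0) : F x ≠ 0 := by
    rw [hF x hx, ← map_smul, Ne, map_eq_zero_iff L hL]
    exact smul_ne_zero (norm_ne_zero_iff.2 hx) (hf.ne_zero _)
  have hFinj : Function.Injective F := by
    intro x y hxy
    by_cases hx : x = 0
    · by_contra hne
      subst hx
      exact hFne y (Ne.symm hne) (hxy ▸ hF0)
    have hy : y ≠ 0 := by
      rintro rfl
      exact hFne x hx (hxy.trans hF0)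
    rw [hF x hx, hF y hy, ← map_smul, ← map_smul] at hxy
    have h := hL hxy
    have huv : u x hx = u y hy := hf.eq_of_smul_eq_smul (norm_ne_zero_iff.2 hx) h
    rw [huv] at h
    have hn : ‖x‖ = ‖y‖ := smul_left_injective ℝ (hf.ne_zero (u y hy)) h
    rw [hu x hx, hu y hy, huv, hn]
  have hFcont : Continuous F := by
    refine continuous_iff_continuousAt.2 fun x => ?_
    by_cases hx : x = 0
    · subst hx
      obtain ⟨C, hC⟩ := isCompact_univ.exists_bound_of_continuousOn
        (hLcont.comp hf.continuous).continuousOn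
      rw [ContinuousAt, hF0]
      refine squeeze_zero_norm (a := fun x => ‖x‖ * C) (fun x => ?_) ?_
      · by_cases hx : x = 0
        · simp [hx, hF0]
        · rw [hF x hx, norm_smul, norm_norm]
          exact mul_le_mul_of_nonneg_left (hC _ (Set.mem_univ _)) (norm_nonneg _)
      · have : Continuous fun x : E => ‖x‖ * C := by fun_prop
        simpa using this.tendsto 0
    · have hopen : IsOpen {x : E | x ≠ 0} := isOpen_ne
      have hucont : Continuous fun x : {x : E // x ≠ 0} => u x x.2 :=
        (((continuous_norm.comp continuous_subtype_val).inv₀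
          fun x => norm_ne_zero_iff.2 x.2).smul continuous_subtype_val).subtype_mk _
      have hres : Continuous fun x : {x : E // x ≠ 0} => F x := by
        have : (fun x : {x : E // x ≠ 0} => F x) =
            fun x : {x : E // x ≠ 0} => ‖(x : E)‖ • L (f (u x x.2)) :=
          funext fun x => hF x x.2
        rw [this]
        exact (continuous_norm.comp continuous_subtype_val).smul
          (hLcont.comp (hf.continuous.comp hucont))
      exact (continuousOn_iff_continuous_domRestrict.2 hres).continuousAt (hopen.mem_nhds hx)
  have hint := Continuous.mem_interior_image_closedBall_of_injOn hFcont.continuousOn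
    hFinj.injOn
  rw [hF0, mem_interior_iff_mem_nhds] at hint
  -- The ray opposite to `f x₀` enters every neighbourhood of `0`, hence the image of `F`.
  have htend : Filter.Tendsto (fun t : ℝ => -t • L (f x₀)) (nhdsWithin 0 (Set.Ioi 0))
      (nhds (0 : E)) := by
    have : Continuous fun t : ℝ => -t • L (f x₀) := by fun_prop
    simpa using (this.tendsto 0).mono_left nhdsWithin_le_nhds
  obtain ⟨t, ⟨y, -, hy⟩, ht⟩ := ((htend.eventually hint).and self_mem_nhdsWithin).exists
  replace ht : 0 < t := ht
  have hy0 : y ≠ 0 := by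
    rintro rfl
    rw [hF0, ← map_smul, eq_comm, map_eq_zero_iff L hL] at hy
    exact smul_ne_zero (neg_ne_zero.2 ht.ne') (hf.ne_zero _) hy
  rw [hF y hy0, ← map_smul, ← map_smul] at hy
  have h := hL hy
  have huv : u y hy0 = x₀ := hf.eq_of_smul_eq_smul (norm_ne_zero_iff.2 hy0) h
  rw [huv] at h
  have : ‖y‖ = -t := smul_left_injective ℝ (hf.ne_zero x₀) h
  linarith [norm_nonneg y]

open Metric in
/-- Injectively linear images of `x ↦ (1, x)` are `3`-regular on the unit sphere, since three
distinct points of a sphere are affinely independent. -/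
theorem exists_isRegularMap_three_sphere {E : Type*} [NormedAddCommGroup E] [InnerProductSpace ℝ E]
    [FiniteDimensional ℝ E] {N : ℕ} (hN : Module.finrank ℝ E < N) :
    ∃ f : sphere (0 : E) 1 → EuclideanSpace ℝ (Fin N), IsRegularMap 3 f := by
  obtain ⟨L, hL⟩ := (finrank_le_iff_exists_linearMap (R := ℝ) (M := ℝ × E)
    (M' := EuclideanSpace ℝ (Fin N))).1 (by simpa [add_comm] using hN)
  have hLcont : Continuous L := L.continuous_of_finiteDimensional
  refine ⟨fun x => L (1, x), by fun_prop, fun x hx => ?_⟩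
  have hsph : EuclideanGeometry.Cospherical (sphere (0 : E) 1) := ⟨0, 1, fun p hp => hp⟩
  have haff := hsph.affineIndependent (p := fun i => (x i : E))
    (by rintro _ ⟨i, rfl⟩; exact (x i).2) (Subtype.val_injective.comp hx)
  rw [Fintype.linearIndependent_iff]
  intro g hg i
  -- The two components of this relation say that `g` is an affine dependence.
  have hg' : ∑ i, g i • ((1, (x i : E)) : ℝ × E) = 0 := by
    rw [← map_eq_zero_iff L hL, map_sum]
    simpa only [map_smul] using hg
  rw [Prod.ext_iff] at hg'
  simp only [Prod.fst_sum, Prod.snd_sum, Prod.smul_fst, Prod.smul_snd, smul_eq_mul, mul_one,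
    Prod.fst_zero, Prod.snd_zero] at hg'
  exact affineIndependent_iff.1 haff Finset.univ g hg'.1 hg'.2 i (Finset.mem_univ i)

theorem corollary1p3 (m N : ℕ) (hm : 2 ≤ m) :
    [∃ f : Metric.sphere (0 : EuclideanSpace ℝ (Fin (m + 1))) 1 → EuclideanSpace ℝ (Fin N),
        IsRegularMap 3 f,
     ∃ f : Metric.sphere (0 : EuclideanSpace ℝ (Fin (m + 1))) 1 → EuclideanSpace ℝ (Fin N),
        IsRegularMap 2 f,
     m + 2 ≤ N].TFAE := by
  have hinf : Infinite (Metric.sphere (0 : EuclideanSpace ℝ (Fin (m + 1))) 1) := by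
    -- A connected set with two points is infinite.
    have hconn := isPreconnected_sphere (E := EuclideanSpace ℝ (Fin (m + 1)))
      (by rw [← Module.finrank_eq_rank, finrank_euclideanSpace_fin]; exact_mod_cast (by lia)) 0 1
    refine (hconn.infinite_of_nontrivial ?_).to_subtype
    exact ⟨EuclideanSpace.single 0 1, by simp, -EuclideanSpace.single 0 1, by simp, fun h => by
      have := congrArg (fun x => x 0) h
      norm_num at this⟩
  tfae_have 1 → 2 := fun ⟨f, hf⟩ => ⟨f, hf.of_succ⟩
  tfae_have 2 → 3 := fun ⟨f, hf⟩ => by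
    have := hf.finrank_lt_of_sphere
    rw [finrank_euclideanSpace_fin] at this
    lia
  tfae_have 3 → 1 := fun h => exists_isRegularMap_three_sphere (by
    rw [finrank_euclideanSpace_fin]
    lia)
  tfae_finish
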